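/- Let $A\in\mathbb C^{n\times n}$ be Hermitian, and let $\mathcal X,\mathcal Y\subseteq\mathbb C^n$ be subspaces of the same dimension $k$, at least one of which is $A$-invariant. Let $X,Y\in\mathbb C^{n\times k}$ be matrices whose columns form orthonormal bases of $\mathcal X$ and $\mathcal Y$, respectively. For a Hermitian matrix $H$ let $\lambda(H)$ be the vector of its eigenvalues, counted with multiplicity, in descending order, and let $\mathrm{spr}(A)=\lambda_1(A)-\lambda_n(A)$. Let $\theta=\theta(\mathcal X,\mathcal Y)\in[0,\pi/2]^k$ be the vector of principal angles between $\mathcal X$ and $\mathcal Y$ in descending order, that is, $\cos\theta_1\le\dots\le\cos\theta_k$ are the singular values of $X^HY$. Then $$|\lambda(X^HAX)-\lambda(Y^HAY)|\ \prec_w\ \mathrm{spr}(A)\left[e-\cos\theta(\mathcal X,\mathcal Y)+\tfrac12\sin^2\theta(\mathcal X,\mathcal Y)\right],$$ where $e=[1,\dots,1]^T$, the absolute value, sine and cosine are taken entrywise, and for $x,y\in\mathbb R^k$ the relation $x\prec_w y$ ($x$ is weakly submajorized by $y$) means that $\sum_{i=1}^j x_i^{\downarrow}\le\sum_{i=1}^j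 y_i^{\downarrow}$ for all $1\le j\le k$, with $x^{\downarrow}$ the vector $x$ rearranged in descending order. -/

import Mathlib

noncomputable section

namespace RitzBounds

/-- The eigenvalues `λ(A)` of a Hermitian `n × n` matrix, repeated by multiplicity and arranged
in descending order: `eigs hA 0` is the largest one and `eigs hA (n - 1)` the smallest one. -/
def eigs {n : ℕ} {A : Matrix (Fin n) (Fin n) ℂ} (hA : A.IsHermitian) : Fin n → ℝ :=
  fun i => hA.eigenvalues₀ (Fin.cast (Fintype.card_fin n).symm i)

/-- The spread `spr(A) = λ₁(A) - λₙ(A)` of the spectrum of a Hermitian matrix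
(`0` for the empty matrix). -/
def spr {n : ℕ} {A : Matrix (Fin n) (Fin n) ℂ} (hA : A.IsHermitian) : ℝ :=
  if h : 0 < n then eigs hA ⟨0, h⟩ - eigs hA ⟨n - 1, by omega⟩ else 0

/-- The `j`-th column of `X` as a vector of the Hermitian space `ℂⁿ`. -/
def column {n k : ℕ} (X : Matrix (Fin n) (Fin k) ℂ) (j : Fin k) : EuclideanSpace ℂ (Fin n) :=
  WithLp.toLp 2 (fun i => X i j)

/-- The columns of `X` form an orthonormal basis of the subspace `S`. -/
def IsOrthonormalBasisOf {n k : ℕ} (X : Matrix (Fin n) (Fin k) ℂ)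
    (S : Submodule ℂ (EuclideanSpace ℂ (Fin n))) : Prop :=
  Orthonormal ℂ (column X) ∧ Submodule.span ℂ (Set.range (column X)) = S

/-- The subspace `S` is `A`-invariant: `A S ⊆ S`. -/
def IsInvariantSubspace {n : ℕ} (A : Matrix (Fin n) (Fin n) ℂ)
    (S : Submodule ℂ (EuclideanSpace ℂ (Fin n))) : Prop :=
  ∀ v ∈ S, A.toEuclideanLin v ∈ S

/-- The singular values of a `k × k` matrix, arranged in descending order. -/
def singVals {k : ℕ} (B : Matrix (Fin k) (Fin k) ℂ) : Fin k → ℝ :=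
  fun i => B.toEuclideanLin.singularValues i

/-- The vector of principal angles between two subspaces of dimension `k`, given by matrices `X`
and `Y` whose columns are orthonormal bases of them. It is determined by: the cosines of the angles
are the singular values of `Xᴴ Y` in ascending order, so that the angles are in descending order.
The value depends on the two column spaces only. -/
def principalAngles {n k : ℕ} (X Y : Matrix (Fin n) (Fin k) ℂ) : Fin k → ℝ :=
  fun i => Real.arccos (singVals (X.conjTranspose * Y) (Fin.rev i))

/-- `x↓`: the entries of `x` rearranged in descending order. -/
def descending {k : ℕ} (x : Fin k → ℝ) : Fin k → ℝ :=
  fun i => x (Tuple.sort x (Fin.rev i))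

/-- `x` is weakly (sub-)majorized by `y`: for each `j`, the sum of the `j` largest entries of `x`
is at most the sum of the `j` largest entries of `y`. -/
def WeaklySubmajorized {k : ℕ} (x y : Fin k → ℝ) : Prop :=
  ∀ j : Fin k, ∑ i ∈ Finset.Iic j, descending x i ≤ ∑ i ∈ Finset.Iic j, descending y i

end RitzBounds

end

/-! Weak majorization is encoded by thresholds: it suffices that for every index set `I` and every
threshold `t` among the entries of `y`, the sum of `x` over `I` is at most `∑ (y i - t)₊ + |I| t`
(`weaklySubmajorized_of_threshold`).

A singular value decomposition of `XᴴY` allows a unitary change of basis of `X`, harmless for Ritz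
values, after which the cross Gram operator is a diagonal `C` with entries `cos θ`. Shifting `A` by
the midpoint of its spectrum moves all Ritz values equally and leaves an operator of norm at most `a
= spr(A)/2`. If the range of `X` is invariant, `X C p` is the orthogonal projection of `Y p` on it,
and the difference of the compressed forms splits exactly (`re_inner_sub_re_inner`) into a term
containing `1 - C`, of size `2a(1 - cos θ)`, and a term quadratic in `Y - XC`, of size `a sin² θ`.

For a threshold `c₀` on the cosines, each term is cut into a multiple of the identity and a
nonnegative form of bounded trace (`exists_abs_re_inner_sub_le`). The Lidskii-type bound
`sum_abs_eigenvalues_sub_le` turns this into the threshold inequality for the eigenvalues. -/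

namespace RitzBounds

open scoped InnerProductSpace

/-! ### Diagonal operators, Weyl monotonicity and a Lidskii-type bound. -/

section Spectral

variable {V : Type*} [NormedAddCommGroup V] [InnerProductSpace ℂ V]
  {ι : Type*} [Fintype ι]

/-- The operator that is diagonal in the orthonormal basis `b` with real diagonal entries `d`. -/
noncomputable def diagOp (b : OrthonormalBasis ι ℂ V) (d : ι → ℝ) : V →ₗ[ℂ] V :=
  b.toBasis.constr ℂ fun i => (d i : ℂ) • b i

lemma diagOp_apply_self (b : OrthonormalBasis ι ℂ V) (d : ι → ℝ) (i : ι) :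
    diagOp b d (b i) = (d i : ℂ) • b i := by
  rw [diagOp, ← b.coe_toBasis, Module.Basis.constr_basis]

lemma inner_diagOp (b : OrthonormalBasis ι ℂ V) (d : ι → ℝ) (i : ι) (x : V) :
    ⟪b i, diagOp b d x⟫_ℂ = d i * ⟪b i, x⟫_ℂ := by
  classical
  conv_lhs => rw [← b.sum_repr' x]
  simp [map_sum, diagOp_apply_self, b.inner_eq_ite]
  ring

lemma diagOp_isSymmetric (b : OrthonormalBasis ι ℂ V) (d : ι → ℝ) :
    (diagOp b d).IsSymmetric := by
  intro x y
  rw [← b.sum_inner_mul_inner, ← b.sum_inner_mul_inner]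
  refine Finset.sum_congr rfl fun i _ => ?_
  rw [← inner_conj_symm (diagOp b d x), inner_diagOp, inner_diagOp, map_mul, inner_conj_symm]
  simp
  ring

/-- The quadratic form of a symmetric operator in an orthonormal basis of eigenvectors. -/
lemma re_inner_eq_sum {T : V →ₗ[ℂ] V} (hT : T.IsSymmetric) (b : OrthonormalBasis ι ℂ V)
    (d : ι → ℝ) (h : ∀ i, T (b i) = (d i : ℂ) • b i) (x : V) :
    RCLike.re ⟪T x, x⟫_ℂ = ∑ i, d i * ‖⟪b i, x⟫_ℂ‖ ^ 2 := by
  rw [← b.sum_inner_mul_inner, map_sum]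
  refine Finset.sum_congr rfl fun i _ => ?_
  rw [hT, h, inner_smul_right, mul_assoc, ← inner_conj_symm x (b i), RCLike.conj_mul]
  rw [← RCLike.ofReal_pow]
  exact (RCLike.re_ofReal_mul (K := ℂ) _ _).trans (by rw [RCLike.ofReal_re])

lemma norm_sq_apply_eq_sum {T : V →ₗ[ℂ] V} (hT : T.IsSymmetric) (b : OrthonormalBasis ι ℂ V)
    (d : ι → ℝ) (h : ∀ i, T (b i) = (d i : ℂ) • b i) (x : V) :
    ‖T x‖ ^ 2 = ∑ i, d i ^ 2 * ‖⟪b i, x⟫_ℂ‖ ^ 2 := by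
  rw [← b.sum_sq_norm_inner_right]
  refine Finset.sum_congr rfl fun i _ => ?_
  rw [← hT, h, inner_smul_left, norm_mul, mul_pow]
  simp

lemma re_inner_diagOp (b : OrthonormalBasis ι ℂ V) (d : ι → ℝ) (x : V) :
    RCLike.re ⟪diagOp b d x, x⟫_ℂ = ∑ i, d i * ‖⟪b i, x⟫_ℂ‖ ^ 2 :=
  re_inner_eq_sum (diagOp_isSymmetric b d) b d (diagOp_apply_self b d) x

lemma norm_sq_diagOp (b : OrthonormalBasis ι ℂ V) (d : ι → ℝ) (x : V) :
    ‖diagOp b d x‖ ^ 2 = ∑ i, d i ^ 2 * ‖⟪b i, x⟫_ℂ‖ ^ 2 :=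
  norm_sq_apply_eq_sum (diagOp_isSymmetric b d) b d (diagOp_apply_self b d) x

lemma norm_apply_le {T : V →ₗ[ℂ] V} (hT : T.IsSymmetric) (b : OrthonormalBasis ι ℂ V)
    (d : ι → ℝ) (h : ∀ i, T (b i) = (d i : ℂ) • b i) {a : ℝ} (ha : 0 ≤ a)
    (hd : ∀ i, |d i| ≤ a) (x : V) : ‖T x‖ ≤ a * ‖x‖ := by
  refine le_of_sq_le_sq ?_ (by positivity)
  rw [norm_sq_apply_eq_sum hT b d h, mul_pow, ← b.sum_sq_norm_inner_right x, Finset.mul_sum]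
  refine Finset.sum_le_sum fun i _ => ?_
  refine mul_le_mul_of_nonneg_right (sq_le_sq.2 ?_) (by positivity)
  rw [abs_of_nonneg ha]
  exact hd i

lemma norm_diagOp_le (b : OrthonormalBasis ι ℂ V) (d : ι → ℝ) {a : ℝ} (ha : 0 ≤ a)
    (hd : ∀ i, |d i| ≤ a) (x : V) : ‖diagOp b d x‖ ≤ a * ‖x‖ :=
  norm_apply_le (diagOp_isSymmetric b d) b d (diagOp_apply_self b d) ha hd x

lemma trace_diagOp (b : OrthonormalBasis ι ℂ V) (d : ι → ℝ) :
    LinearMap.trace ℂ V (diagOp b d) = ∑ i, (d i : ℂ) := by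
  classical
  rw [LinearMap.trace_eq_sum_inner _ b]
  exact Finset.sum_congr rfl fun i _ => by rw [diagOp_apply_self, inner_smul_right]; simp

variable [FiniteDimensional ℂ V]
  {V' : Type*} [NormedAddCommGroup V'] [InnerProductSpace ℂ V'] [FiniteDimensional ℂ V'] {n : ℕ}

lemma trace_eq_sum_eigenvalues {T : V →ₗ[ℂ] V} (hT : T.IsSymmetric)
    (hn : Module.finrank ℂ V = n) :
    LinearMap.trace ℂ V T = ∑ i, (hT.eigenvalues hn i : ℂ) := by
  rw [LinearMap.trace_eq_sum_inner _ (hT.eigenvectorBasis hn)]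
  refine Finset.sum_congr rfl fun i _ => ?_
  rw [hT.apply_eigenvectorBasis, inner_smul_right]
  simp

/-- **Weyl's monotonicity theorem** for the eigenvalues in descending order. -/
lemma eigenvalues_le_add {S : V →ₗ[ℂ] V} {T : V' →ₗ[ℂ] V'} (hS : S.IsSymmetric)
    (hT : T.IsSymmetric) (hn : Module.finrank ℂ V = n) (hn' : Module.finrank ℂ V' = n)
    (U : V →ₗᵢ[ℂ] V') {t : ℝ}
    (h : ∀ x, RCLike.re ⟪S x, x⟫_ℂ ≤ RCLike.re ⟪T (U x), U x⟫_ℂ + t * ‖x‖ ^ 2) (i : Fin n) :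
    hS.eigenvalues hn i ≤ hT.eigenvalues hn' i + t := by
  set e := hS.eigenvectorBasis hn
  set f := hT.eigenvectorBasis hn'
  -- The `i`-th coordinate is zero, so `L` is not surjective and has a nonzero kernel vector. It is
  -- orthogonal to every `e j` with `j > i`, and its image under `U` to every `f j` with `j < i`.
  let L : V →ₗ[ℂ] (Fin n → ℂ) := LinearMap.pi fun j =>
    if j < i then (innerSL ℂ (f j)).toLinearMap ∘ₗ U.toLinearMap
    else if i < j then (innerSL ℂ (e j)).toLinearMap else 0
  have hL : ¬ Function.Injective L := by
    rw [LinearMap.injective_iff_surjective_of_finrank_eq_finrank (by simp [hn])]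
    intro hsurj
    obtain ⟨x, hx⟩ := hsurj (Pi.single i 1)
    have := congrFun hx i
    simp [L] at this
  rw [← LinearMap.ker_eq_bot, Submodule.eq_bot_iff] at hL
  push Not at hL
  obtain ⟨x, hx, hx0⟩ := hL
  have hf : ∀ j < i, ⟪f j, U x⟫_ℂ = 0 := fun j hj => by
    have := congrFun hx j
    simpa [L, hj] using this
  have he : ∀ j, i < j → ⟪e j, x⟫_ℂ = 0 := fun j hj => by
    have := congrFun hx j
    simpa [L, hj, hj.not_gt] using this
  have h1 : hS.eigenvalues hn i * ‖x‖ ^ 2 ≤ RCLike.re ⟪S x, x⟫_ℂ := by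
    rw [re_inner_eq_sum hS e _ (hS.apply_eigenvectorBasis hn), ← e.sum_sq_norm_inner_right,
      Finset.mul_sum]
    refine Finset.sum_le_sum fun j _ => ?_
    rcases le_or_gt j i with hj | hj
    · gcongr
      exact hS.eigenvalues_antitone hn hj
    · simp [he j hj]
  have h2 : RCLike.re ⟪T (U x), U x⟫_ℂ ≤ hT.eigenvalues hn' i * ‖x‖ ^ 2 := by
    rw [re_inner_eq_sum hT f _ (hT.apply_eigenvectorBasis hn'), ← U.norm_map x,
      ← f.sum_sq_norm_inner_right, Finset.mul_sum]
    refine Finset.sum_le_sum fun j _ => ?_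
    rcases le_or_gt i j with hj | hj
    · gcongr
      exact hT.eigenvalues_antitone hn' hj
    · simp [hf j hj]
  have hpos : 0 < ‖x‖ ^ 2 := by positivity
  have := h x
  nlinarith

/-- A bound of Lidskii type for the eigenvalues of a perturbed symmetric operator, with a
threshold `τ`. -/
lemma sum_abs_eigenvalues_sub_le {S T : V →ₗ[ℂ] V} (hS : S.IsSymmetric) (hT : T.IsSymmetric)
    (hn : Module.finrank ℂ V = n) {q : V → ℝ} {τ R : ℝ} (hτ : 0 ≤ τ) (hq : ∀ x, 0 ≤ q x)
    (h : ∀ x, |RCLike.re ⟪S x, x⟫_ℂ - RCLike.re ⟪T x, x⟫_ℂ| ≤ τ * ‖x‖ ^ 2 + q x)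
    (hR : ∀ v : OrthonormalBasis (Fin n) ℂ V, ∑ i, q (v i) ≤ R) (I : Finset (Fin n)) :
    ∑ i ∈ I, |hS.eigenvalues hn i - hT.eigenvalues hn i| ≤ R + I.card * τ := by
  have hD : (S - T).IsSymmetric := hS.sub hT
  set v := hD.eigenvectorBasis hn
  set μ := hD.eigenvalues hn
  have hv : ∀ i, (S - T) (v i) = (μ i : ℂ) • v i := hD.apply_eigenvectorBasis hn
  -- `T + P` dominates both `T` and `S - τ`, while `S + N` dominates both `S` and `T - τ`. The
  -- eigenvalue increments from `T` to `T + P` and from `S` to `S + N` are therefore nonnegative, so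
  -- a sum over `I` extends to all indices, where it is a trace.
  set P := diagOp v fun i => max (μ i - τ) 0
  set N := diagOp v fun i => max (-μ i - τ) 0
  have hTP : (T + P).IsSymmetric := hT.add (diagOp_isSymmetric _ _)
  have hSN : (S + N).IsSymmetric := hS.add (diagOp_isSymmetric _ _)
  have hquad : ∀ x, RCLike.re ⟪S x, x⟫_ℂ - RCLike.re ⟪T x, x⟫_ℂ
      = ∑ i, μ i * ‖⟪v i, x⟫_ℂ‖ ^ 2 := fun x => by
    rw [← re_inner_eq_sum hD v μ hv, LinearMap.sub_apply, inner_sub_left, map_sub]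
  have hsq : ∀ x, τ * ‖x‖ ^ 2 = ∑ i, τ * ‖⟪v i, x⟫_ℂ‖ ^ 2 := fun x => by
    rw [← v.sum_sq_norm_inner_right, Finset.mul_sum]
  have hP0 : ∀ x, 0 ≤ RCLike.re ⟪P x, x⟫_ℂ := fun x => by
    rw [re_inner_diagOp]; exact Finset.sum_nonneg fun i _ => by positivity
  have hN0 : ∀ x, 0 ≤ RCLike.re ⟪N x, x⟫_ℂ := fun x => by
    rw [re_inner_diagOp]; exact Finset.sum_nonneg fun i _ => by positivity
  have hP1 : ∀ x, ∑ i, μ i * ‖⟪v i, x⟫_ℂ‖ ^ 2 ≤ RCLike.re ⟪P x, x⟫_ℂ + τ * ‖x‖ ^ 2 := fun x => by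
    rw [re_inner_diagOp, hsq, ← Finset.sum_add_distrib]
    refine Finset.sum_le_sum fun i _ => ?_
    rw [← add_mul]
    gcongr
    linarith [le_max_left (μ i - τ) 0]
  have hN1 : ∀ x, -∑ i, μ i * ‖⟪v i, x⟫_ℂ‖ ^ 2 ≤ RCLike.re ⟪N x, x⟫_ℂ + τ * ‖x‖ ^ 2 := fun x => by
    rw [re_inner_diagOp, hsq, ← Finset.sum_add_distrib, ← Finset.sum_neg_distrib]
    refine Finset.sum_le_sum fun i _ => ?_
    rw [← add_mul, ← neg_mul]
    gcongr
    linarith [le_max_left (-μ i - τ) 0]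
  have w1 : ∀ i, hS.eigenvalues hn i ≤ hTP.eigenvalues hn i + τ :=
    eigenvalues_le_add hS hTP hn hn .id fun x => by
      have := hP1 x
      rw [← hquad] at this
      simp only [LinearIsometry.id_apply, LinearMap.add_apply, inner_add_left, map_add]
      linarith
  have w2 : ∀ i, hT.eigenvalues hn i ≤ hSN.eigenvalues hn i + τ :=
    eigenvalues_le_add hT hSN hn hn .id fun x => by
      have := hN1 x
      rw [← hquad] at this
      simp only [LinearIsometry.id_apply, LinearMap.add_apply, inner_add_left, map_add]
      linarith
  have w3 : ∀ i, hT.eigenvalues hn i ≤ hTP.eigenvalues hn i + 0 :=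
    eigenvalues_le_add hT hTP hn hn .id fun x => by
      simp only [LinearIsometry.id_apply, LinearMap.add_apply, inner_add_left, map_add]
      linarith [hP0 x]
  have w4 : ∀ i, hS.eigenvalues hn i ≤ hSN.eigenvalues hn i + 0 :=
    eigenvalues_le_add hS hSN hn hn .id fun x => by
      simp only [LinearIsometry.id_apply, LinearMap.add_apply, inner_add_left, map_add]
      linarith [hN0 x]
  have t1 : ∑ i, (hTP.eigenvalues hn i - hT.eigenvalues hn i) = ∑ i, max (μ i - τ) 0 := by
    have h1 := trace_eq_sum_eigenvalues hTP hn
    rw [map_add, trace_eq_sum_eigenvalues hT hn, trace_diagOp] at h1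
    rw [Finset.sum_sub_distrib, sub_eq_iff_eq_add']
    exact_mod_cast h1.symm
  have t2 : ∑ i, (hSN.eigenvalues hn i - hS.eigenvalues hn i) = ∑ i, max (-μ i - τ) 0 := by
    have h1 := trace_eq_sum_eigenvalues hSN hn
    rw [map_add, trace_eq_sum_eigenvalues hS hn, trace_diagOp] at h1
    rw [Finset.sum_sub_distrib, sub_eq_iff_eq_add']
    exact_mod_cast h1.symm
  calc ∑ i ∈ I, |hS.eigenvalues hn i - hT.eigenvalues hn i|
      ≤ ∑ i ∈ I, (((hTP.eigenvalues hn i - hT.eigenvalues hn i)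
          + (hSN.eigenvalues hn i - hS.eigenvalues hn i)) + τ) := by
        refine Finset.sum_le_sum fun i _ => ?_
        rw [abs_le]
        constructor <;> linarith [w1 i, w2 i, w3 i, w4 i]
    _ = ∑ i ∈ I, ((hTP.eigenvalues hn i - hT.eigenvalues hn i)
          + (hSN.eigenvalues hn i - hS.eigenvalues hn i)) + I.card * τ := by
        rw [Finset.sum_add_distrib, Finset.sum_const, nsmul_eq_mul]
    _ ≤ ∑ i, ((hTP.eigenvalues hn i - hT.eigenvalues hn i)
          + (hSN.eigenvalues hn i - hS.eigenvalues hn i)) + I.card * τ := by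
        gcongr
        · exact fun i _ _ => by linarith [w3 i, w4 i]
        · exact Finset.subset_univ I
    _ = ∑ i, (max (μ i - τ) 0 + max (-μ i - τ) 0) + I.card * τ := by
        rw [Finset.sum_add_distrib, t1, t2, Finset.sum_add_distrib]
    _ ≤ ∑ i, q (v i) + I.card * τ := by
        gcongr with i
        have h1 := h (v i)
        rw [← map_sub, ← inner_sub_left, ← LinearMap.sub_apply, hv, inner_smul_left,
          inner_self_eq_norm_sq_to_K] at h1
        simp at h1
        have h2 := hq (v i)
        rw [abs_le] at h1
        -- Since `τ ≥ 0`, the two positive parts add up to `(|μ i| - τ)₊`, which `q (v i)` bounds.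
        rcases max_cases (μ i - τ) 0 with ⟨a, _⟩ | ⟨a, _⟩ <;>
        rcases max_cases (-μ i - τ) 0 with ⟨b, _⟩ | ⟨b, _⟩ <;> rw [a, b] <;> linarith
    _ ≤ R + I.card * τ := by gcongr; exact hR v

end Spectral

/-! ### Perturbation of the compressed quadratic form. -/

section Perturbation

variable {V W : Type*} [NormedAddCommGroup V] [InnerProductSpace ℂ V]
  [NormedAddCommGroup W] [InnerProductSpace ℂ W] {ι : Type*} [Fintype ι]

/-- Cuts `1 - C` at the threshold: the first part is charged to the trace, and the second has norm
at most `1 - c₀` once `c ≤ 1` and `c₀ ≤ 1`. -/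
lemma self_sub_diagOp (b : OrthonormalBasis ι ℂ V) (c : ι → ℝ) (c₀ : ℝ) (p : V) :
    p - diagOp b c p =
      diagOp b (fun i => max (c₀ - c i) 0) p + diagOp b (fun i => 1 - max c₀ (c i)) p := by
  refine b.repr.injective (PiLp.ext fun i => ?_)
  rw [b.repr_apply_apply, b.repr_apply_apply, inner_sub_right, inner_add_right, inner_diagOp, inner_diagOp, inner_diagOp,
    ← add_mul, ← one_sub_mul]
  congr 1
  norm_cast
  rcases max_cases (c₀ - c i) 0 with ⟨h, _⟩ | ⟨h, _⟩ <;>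
  rcases max_cases c₀ (c i) with ⟨h', _⟩ | ⟨h', _⟩ <;> rw [h, h'] <;> linarith

/-- The change of the compressed quadratic form, when one of the two subspaces is invariant. -/
lemma re_inner_sub_re_inner {A : W →ₗ[ℂ] W} (hA : A.IsSymmetric) {X Y : V →ₗᵢ[ℂ] W}
    {C : V →ₗ[ℂ] V} (hXY : ∀ p q, ⟪X p, Y q⟫_ℂ = ⟪p, C q⟫_ℂ) (hinv : ∀ p, ∃ q, A (X p) = X q)
    (p : V) :
    RCLike.re ⟪A (X p), X p⟫_ℂ - RCLike.re ⟪A (Y p), Y p⟫_ℂ =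
      RCLike.re ⟪X (p - C p), A (X (p + C p))⟫_ℂ
        - RCLike.re ⟪A (Y p - X (C p)), Y p - X (C p)⟫_ℂ := by
  -- Invariance puts `A (X (C p))` in the range of `X`, so pairing it with `Y p` or with the
  -- projection `X (C p)` gives the same value.
  obtain ⟨r, hr⟩ := hinv (C p)
  have h1 : ⟪A (X (C p)), Y p⟫_ℂ = ⟪A (X (C p)), X (C p)⟫_ℂ := by
    rw [hr, hXY, X.inner_map_map]
  have h2 : ⟪A (Y p), X (C p)⟫_ℂ = ⟪X (C p), A (X (C p))⟫_ℂ := by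
    rw [hA, ← inner_conj_symm, h1, inner_conj_symm]
  have h3 : RCLike.re ⟪A (X (C p)), X (C p)⟫_ℂ = RCLike.re ⟪X (C p), A (X (C p))⟫_ℂ := by
    rw [hA]
  have h4 : RCLike.re ⟪X (C p), A (X p)⟫_ℂ = RCLike.re ⟪X p, A (X (C p))⟫_ℂ := by
    rw [inner_re_symm, hA]
  have h5 : RCLike.re ⟪A (X p), X p⟫_ℂ = RCLike.re ⟪X p, A (X p)⟫_ℂ := by rw [hA]
  simp only [map_sub, map_add, inner_sub_left, inner_sub_right, inner_add_right, h1, h2, h3, h4, h5]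
  ring

/-- Pythagoras: `X (C p)` is the orthogonal projection of `Y p` on the range of `X`. This is the
source of `sin² θ = 1 - cos² θ`. -/
lemma norm_sq_sub_map {X Y : V →ₗᵢ[ℂ] W} {C : V →ₗ[ℂ] V}
    (hXY : ∀ p q, ⟪X p, Y q⟫_ℂ = ⟪p, C q⟫_ℂ) (p : V) :
    ‖Y p - X (C p)‖ ^ 2 = ‖p‖ ^ 2 - ‖C p‖ ^ 2 := by
  rw [norm_sub_sq (𝕜 := ℂ), inner_re_symm, hXY, inner_self_eq_norm_sq, Y.norm_map, X.norm_map]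
  ring

/-- The change of the compressed quadratic form is bounded, for each threshold `c₀`, by a multiple
of the identity plus a nonnegative form of controlled trace. -/
lemma exists_abs_re_inner_sub_le {A : W →ₗ[ℂ] W} (hA : A.IsSymmetric) {a : ℝ} (ha : 0 ≤ a)
    (hAa : ∀ w, ‖A w‖ ≤ a * ‖w‖) {X Y : V →ₗᵢ[ℂ] W} (b : OrthonormalBasis ι ℂ V) {c : ι → ℝ}
    (hc0 : ∀ i, 0 ≤ c i) (hc1 : ∀ i, c i ≤ 1)
    (hXY : ∀ p q, ⟪X p, Y q⟫_ℂ = ⟪p, diagOp b c q⟫_ℂ) (hinv : ∀ p, ∃ q, A (X p) = X q)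
    {c₀ : ℝ} (h1 : c₀ ≤ 1) :
    ∃ q : V → ℝ, (∀ p, 0 ≤ q p) ∧
      (∀ p, |RCLike.re ⟪A (X p), X p⟫_ℂ - RCLike.re ⟪A (Y p), Y p⟫_ℂ| ≤
        2 * a * ((1 - c₀) + 1 / 2 * (1 - c₀ ^ 2)) * ‖p‖ ^ 2 + q p) ∧
      ∀ v : OrthonormalBasis ι ℂ V, ∑ i, q (v i) ≤
        ∑ i, 2 * a * (max (c₀ - c i) 0 + 1 / 2 * max (c₀ ^ 2 - c i ^ 2) 0) := by
  set C := diagOp b c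
  have hCn : ∀ p, ‖C p‖ ≤ ‖p‖ := fun p => by
    simpa using norm_diagOp_le b c zero_le_one
      (fun i => by rw [abs_of_nonneg (hc0 i)]; exact hc1 i) p
  choose M hM using hinv
  have hMn : ∀ p, ‖M p‖ ≤ a * ‖p‖ := fun p => by
    rw [← X.norm_map, ← hM, ← X.norm_map p]; exact hAa _
  -- `M` is `A` restricted to the invariant range of `X`, and `g i` is the adjoint of `M (1 + C)`
  -- applied to `b i`.
  set g : ι → V := fun i => M (b i) + C (M (b i))
  have hg : ∀ i, ‖g i‖ ≤ 2 * a := fun i => by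
    have h2 := hMn (b i)
    rw [b.norm_eq_one, mul_one] at h2
    linarith [norm_add_le (M (b i)) (C (M (b i))), hCn (M (b i))]
  have hgp : ∀ i p, ⟪b i, M (p + C p)⟫_ℂ = ⟪g i, p⟫_ℂ := fun i p => by
    rw [← X.inner_map_map, ← hM, ← hA, hM, X.inner_map_map, inner_add_left, inner_add_right,
      diagOp_isSymmetric b c]
  -- The product `‖⟪b i, p⟫‖ ‖⟪g i, p⟫‖` is replaced by a quadratic form through the AM-GM
  -- inequality. The weight `2 * a` makes the trace of each such form at most `2 * a`, because `‖b
  -- i‖ = 1` and `‖g i‖ ≤ 2 * a`.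
  refine ⟨fun p => ∑ i, (max (c₀ - c i) 0 *
      (1 / 2 * (2 * a * ‖⟪b i, p⟫_ℂ‖ ^ 2 + ‖⟪g i, p⟫_ℂ‖ ^ 2 / (2 * a)))
      + a * (max (c₀ ^ 2 - c i ^ 2) 0 * ‖⟪b i, p⟫_ℂ‖ ^ 2)),
    fun p => Finset.sum_nonneg fun i _ => by positivity, fun p => ?_, fun v => ?_⟩
  · have e1 : |RCLike.re ⟪A (Y p - X (C p)), Y p - X (C p)⟫_ℂ| ≤
        a * ((1 - c₀ ^ 2) * ‖p‖ ^ 2) + ∑ i, a * (max (c₀ ^ 2 - c i ^ 2) 0 * ‖⟪b i, p⟫_ℂ‖ ^ 2) := by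
      calc |RCLike.re ⟪A (Y p - X (C p)), Y p - X (C p)⟫_ℂ|
          ≤ ‖A (Y p - X (C p))‖ * ‖Y p - X (C p)‖ :=
            (RCLike.abs_re_le_norm _).trans (norm_inner_le_norm _ _)
        _ ≤ a * ‖Y p - X (C p)‖ * ‖Y p - X (C p)‖ := by gcongr; exact hAa _
        _ = a * (‖p‖ ^ 2 - ‖C p‖ ^ 2) := by rw [← norm_sq_sub_map hXY]; ring
        _ ≤ _ := by
          rw [← Finset.mul_sum, ← mul_add]
          gcongr
          rw [norm_sq_diagOp, ← b.sum_sq_norm_inner_right p, Finset.mul_sum,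
            ← Finset.sum_sub_distrib, ← Finset.sum_add_distrib]
          refine Finset.sum_le_sum fun i _ => ?_
          nlinarith [le_max_left (c₀ ^ 2 - c i ^ 2) 0, sq_nonneg ‖⟪b i, p⟫_ℂ‖]
    have e2 : |RCLike.re ⟪X (p - C p), A (X (p + C p))⟫_ℂ| ≤
        2 * a * (1 - c₀) * ‖p‖ ^ 2 + ∑ i, max (c₀ - c i) 0 *
          (1 / 2 * (2 * a * ‖⟪b i, p⟫_ℂ‖ ^ 2 + ‖⟪g i, p⟫_ℂ‖ ^ 2 / (2 * a))) := by
      rw [hM, X.inner_map_map, self_sub_diagOp b c c₀, inner_add_left, map_add,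
        add_comm (2 * a * _ * _)]
      refine (abs_add_le _ _).trans (add_le_add ?_ ?_)
      · refine (RCLike.abs_re_le_norm _).trans ?_
        rw [← b.sum_inner_mul_inner]
        refine (norm_sum_le _ _).trans (Finset.sum_le_sum fun i _ => ?_)
        rw [norm_mul, norm_inner_symm, inner_diagOp, norm_mul, mul_assoc, hgp, Complex.norm_real, Real.norm_eq_abs,
          abs_of_nonneg (le_max_right _ _)]
        refine mul_le_mul_of_nonneg_left ?_ (le_max_right _ _)
        -- For `a = 0` the quotient by `2 * a` is `0` by convention, and `g i = 0`.
        rcases ha.eq_or_lt with h | h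
        · have : g i = 0 := by
            rw [← norm_le_zero_iff]
            simpa [← h] using hg i
          simp [this, ← h]
        · have h2 : 0 < 2 * a := by positivity
          have h3 := sq_nonneg (2 * a * ‖⟪b i, p⟫_ℂ‖ - ‖⟪g i, p⟫_ℂ‖)
          have h4 : 1 / 2 * (2 * a * ‖⟪b i, p⟫_ℂ‖ ^ 2 + ‖⟪g i, p⟫_ℂ‖ ^ 2 / (2 * a))
              - ‖⟪b i, p⟫_ℂ‖ * ‖⟪g i, p⟫_ℂ‖
              = (2 * a * ‖⟪b i, p⟫_ℂ‖ - ‖⟪g i, p⟫_ℂ‖) ^ 2 / (2 * (2 * a)) := by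
            field_simp
            ring
          have h5 : 0 ≤ (2 * a * ‖⟪b i, p⟫_ℂ‖ - ‖⟪g i, p⟫_ℂ‖) ^ 2 / (2 * (2 * a)) := by positivity
          linarith
      · refine (RCLike.abs_re_le_norm _).trans ((norm_inner_le_norm _ _).trans ?_)
        have h2 : ‖diagOp b (fun i => 1 - max c₀ (c i)) p‖ ≤ (1 - c₀) * ‖p‖ :=
          norm_diagOp_le b _ (by linarith) (fun i => by
            rw [abs_of_nonneg (by linarith [max_le h1 (hc1 i)])]
            linarith [le_max_left c₀ (c i)]) p
        have h3 : ‖M (p + C p)‖ ≤ 2 * a * ‖p‖ := (hMn _).trans (by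
          have := mul_le_mul_of_nonneg_left ((norm_add_le p (C p)).trans
            (add_le_add_right (hCn p) _)) ha
          linarith)
        calc _ ≤ ((1 - c₀) * ‖p‖) * (2 * a * ‖p‖) := by gcongr
          _ = _ := by ring
    rw [re_inner_sub_re_inner hA hXY (fun p => ⟨M p, hM p⟩)]
    simp only [Finset.sum_add_distrib]
    refine (abs_sub _ _).trans ?_
    linarith
  · rw [Finset.sum_comm]
    refine Finset.sum_le_sum fun i _ => ?_
    rw [Finset.sum_add_distrib, ← Finset.mul_sum, ← Finset.mul_sum, ← Finset.mul_sum,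
      ← Finset.mul_sum, Finset.sum_add_distrib, ← Finset.mul_sum, ← Finset.sum_div,
      v.sum_sq_norm_inner_left, v.sum_sq_norm_inner_left, b.norm_eq_one]
    have h2 : ‖g i‖ ^ 2 / (2 * a) ≤ 2 * a := by
      refine div_le_of_le_mul₀ (by positivity) (by positivity) ?_
      nlinarith [hg i, norm_nonneg (g i)]
    have h3 : 1 / 2 * (2 * a * 1 ^ 2 + ‖g i‖ ^ 2 / (2 * a)) ≤ 2 * a := by linarith
    have h4 := mul_le_mul_of_nonneg_left h3 (le_max_right (c₀ - c i) 0)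
    linarith

end Perturbation

/-! ### Singular value bases and the threshold bound for Ritz values. -/

section RitzValues

variable {V W : Type*} [NormedAddCommGroup V] [InnerProductSpace ℂ V] [FiniteDimensional ℂ V]
  [NormedAddCommGroup W] [InnerProductSpace ℂ W] {n : ℕ}

/-- The singular value decomposition of an operator. -/
lemma exists_singularValue_bases (T : V →ₗ[ℂ] V) (hn : Module.finrank ℂ V = n) :
    ∃ v u : OrthonormalBasis (Fin n) ℂ V,
      ∀ i, T (v i) = ((T.singularValues i : ℝ) : ℂ) • u i := by
  set v := T.isSymmetric_adjoint_comp_self.eigenvectorBasis hn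
  have hv : ∀ i, (LinearMap.adjoint T ∘ₗ T) (v i)
      = ((T.singularValues i ^ 2 : ℝ) : ℂ) • v i := fun i => by
    rw [T.sq_singularValues_fin hn]
    exact T.isSymmetric_adjoint_comp_self.apply_eigenvectorBasis hn i
  have hin : ∀ i j, ⟪T (v i), T (v j)⟫_ℂ
      = if i = j then ((T.singularValues i ^ 2 : ℝ) : ℂ) else 0 := fun i j => by
    rw [← LinearMap.adjoint_inner_right, ← LinearMap.comp_apply, hv, inner_smul_right,
      v.inner_eq_ite]
    split_ifs with h
    · rw [h, mul_one]
    · rw [mul_zero]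
  -- Only the nonzero singular values determine vectors `u i`; elsewhere `T (v i) = 0`, and any
  -- orthonormal completion serves.
  have hon : Orthonormal ℂ (({i | T.singularValues i ≠ 0} : Set (Fin n)).domRestrict
      fun i => (((T.singularValues i)⁻¹ : ℝ) : ℂ) • T (v i)) := by
    rw [orthonormal_iff_ite]
    rintro ⟨i, hi⟩ ⟨j, hj⟩
    have hi' : T.singularValues i ≠ 0 := hi
    simp only [Set.domRestrict_apply, inner_smul_left, inner_smul_right, hin, Subtype.mk.injEq]
    split_ifs with h
    · subst h
      rw [Complex.conj_ofReal, ← Complex.ofReal_mul, ← Complex.ofReal_mul, ← Complex.ofReal_one]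
      congr 1
      field_simp
    · simp
  obtain ⟨u, hu⟩ := hon.exists_orthonormalBasis_extension_of_card_eq (by simp [hn])
  refine ⟨v, u, fun i => ?_⟩
  by_cases h : T.singularValues i = 0
  · have := hin i i
    rw [if_pos rfl, h] at this
    rw [h]
    simpa using this
  · rw [hu i h, smul_smul, ← Complex.ofReal_mul, mul_inv_cancel₀ h]
    simp

/-- Weyl monotonicity with zero shift, applied to `U` and to its inverse. -/
lemma eigenvalues_eq_of_inner_eq {V' : Type*} [NormedAddCommGroup V'] [InnerProductSpace ℂ V']
    [FiniteDimensional ℂ V'] {S : V →ₗ[ℂ] V} {T : V' →ₗ[ℂ] V'} (hS : S.IsSymmetric)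
    (hT : T.IsSymmetric) (hn : Module.finrank ℂ V = n) (hn' : Module.finrank ℂ V' = n)
    (U : V ≃ₗᵢ[ℂ] V') (h : ∀ x, RCLike.re ⟪S x, x⟫_ℂ = RCLike.re ⟪T (U x), U x⟫_ℂ) :
    hS.eigenvalues hn = hT.eigenvalues hn' := by
  funext i
  apply le_antisymm
  · simpa using eigenvalues_le_add hS hT hn hn' U.toLinearIsometry (t := 0)
      (fun x => by simp [h]) i
  · simpa using eigenvalues_le_add hT hS hn' hn U.symm.toLinearIsometry (t := 0)
      (fun x => by simp [h]) i

/-- The bound on the change of the Ritz values, with a threshold `c₀` for the cosines of the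
principal angles. -/
lemma sum_abs_ritz_sub_le {A : W →ₗ[ℂ] W} (hA : A.IsSymmetric) {m a : ℝ} (ha : 0 ≤ a)
    (hAa : ∀ w, ‖A w - (m : ℂ) • w‖ ≤ a * ‖w‖) {X Y : V →ₗᵢ[ℂ] W}
    (hinv : (∀ p, ∃ q, A (X p) = X q) ∨ ∀ p, ∃ q, A (Y p) = Y q)
    {S T K : V →ₗ[ℂ] V} (hS : S.IsSymmetric) (hT : T.IsSymmetric)
    (hSA : ∀ p, ⟪S p, p⟫_ℂ = ⟪A (X p), X p⟫_ℂ) (hTA : ∀ p, ⟪T p, p⟫_ℂ = ⟪A (Y p), Y p⟫_ℂ)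
    (hK : ∀ p q, ⟪X p, Y q⟫_ℂ = ⟪p, K q⟫_ℂ) (hn : Module.finrank ℂ V = n)
    {c₀ : ℝ} (h0 : 0 ≤ c₀) (h1 : c₀ ≤ 1) (I : Finset (Fin n)) :
    ∑ i ∈ I, |hS.eigenvalues hn i - hT.eigenvalues hn i| ≤
      ∑ i : Fin n, 2 * a * (max (c₀ - K.singularValues i) 0
        + 1 / 2 * max (c₀ ^ 2 - K.singularValues i ^ 2) 0)
      + I.card * (2 * a * ((1 - c₀) + 1 / 2 * (1 - c₀ ^ 2))) := by
  obtain ⟨v, u, huv⟩ := exists_singularValue_bases K hn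
  set c : Fin n → ℝ := fun i => K.singularValues i
  -- The unitary factor of a polar decomposition of `K`; composing `X` with it makes the cross Gram
  -- operator diagonal and nonnegative.
  set U : V ≃ₗᵢ[ℂ] V := v.equiv u (Equiv.refl _)
  have hKU : ∀ q, K q = U (diagOp v c q) := by
    have : K = U.toLinearEquiv.toLinearMap ∘ₗ diagOp v c := by
      refine v.toBasis.ext fun i => ?_
      simp only [v.coe_toBasis, LinearMap.comp_apply, diagOp_apply_self, huv, map_smul]
      congr 1
      exact (v.equiv_apply_basis u (Equiv.refl _) i).symm
    intro q
    rw [this]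
    rfl
  set X' : V →ₗᵢ[ℂ] W := X.comp U.toLinearIsometry
  have hX' : ∀ p, X' p = X (U p) := fun p => rfl
  have hXY : ∀ p q, ⟪X' p, Y q⟫_ℂ = ⟪p, diagOp v c q⟫_ℂ := fun p q => by
    rw [hX', hK, hKU, U.inner_map_map]
  have hYX : ∀ p q, ⟪Y p, X' q⟫_ℂ = ⟪p, diagOp v c q⟫_ℂ := fun p q => by
    rw [← inner_conj_symm, hXY, inner_conj_symm, diagOp_isSymmetric v c]
  have hc0 : ∀ i, 0 ≤ c i := fun i => K.singularValues_nonneg i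
  have hc1 : ∀ i, c i ≤ 1 := fun i => by
    have h2 := norm_inner_le_norm (𝕜 := ℂ) (X' (v i)) (Y (v i))
    rw [hXY, inner_diagOp] at h2
    simpa [abs_of_nonneg (hc0 i)] using h2
  set B : W →ₗ[ℂ] W := A - (m : ℂ) • LinearMap.id
  have hBapp : ∀ w, B w = A w - (m : ℂ) • w := fun w => rfl
  have hB : B.IsSymmetric := fun x y => by
    simp only [hBapp, inner_sub_left, inner_sub_right, inner_smul_left, inner_smul_right, hA x y,
      Complex.conj_ofReal]
  have hBa : ∀ w, ‖B w‖ ≤ a * ‖w‖ := hAa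
  have hq : ∃ q : V → ℝ, (∀ p, 0 ≤ q p) ∧
      (∀ p, |RCLike.re ⟪B (X' p), X' p⟫_ℂ - RCLike.re ⟪B (Y p), Y p⟫_ℂ| ≤
        2 * a * ((1 - c₀) + 1 / 2 * (1 - c₀ ^ 2)) * ‖p‖ ^ 2 + q p) ∧
      ∀ v : OrthonormalBasis (Fin n) ℂ V, ∑ i, q (v i) ≤
        ∑ i, 2 * a * (max (c₀ - c i) 0 + 1 / 2 * max (c₀ ^ 2 - c i ^ 2) 0) := by
    rcases hinv with hinv | hinv
    · refine exists_abs_re_inner_sub_le hB ha hBa v hc0 hc1 hXY (fun p => ?_) h1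
      obtain ⟨r, hr⟩ := hinv (U p)
      refine ⟨U.symm (r - (m : ℂ) • U p), ?_⟩
      rw [hX', hX', hBapp, hr, U.apply_symm_apply, map_sub, map_smul]
    -- The roles of `X'` and `Y` can be exchanged because the diagonal cross Gram operator is
    -- self-adjoint.
    · simp_rw [abs_sub_comm (RCLike.re ⟪B (X' _), X' _⟫_ℂ)]
      refine exists_abs_re_inner_sub_le hB ha hBa v hc0 hc1 hYX (fun p => ?_) h1
      obtain ⟨r, hr⟩ := hinv p
      refine ⟨r - (m : ℂ) • p, ?_⟩
      rw [hBapp, hr, map_sub, map_smul]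
  obtain ⟨q, hq0, hq1, hq2⟩ := hq
  set S' : V →ₗ[ℂ] V := U.symm.toLinearEquiv.toLinearMap ∘ₗ S ∘ₗ U.toLinearEquiv.toLinearMap
  have hS'app : ∀ p, S' p = U.symm (S (U p)) := fun p => rfl
  have hS'in : ∀ p q, ⟪S' p, q⟫_ℂ = ⟪S (U p), U q⟫_ℂ := fun p q => by
    rw [← U.inner_map_map, hS'app, U.apply_symm_apply]
  have hS' : S'.IsSymmetric := fun p q => by
    rw [hS'in, hS, ← inner_conj_symm, ← hS'in, inner_conj_symm]
  rw [← eigenvalues_eq_of_inner_eq hS' hS hn hn U fun x => by rw [hS'in]]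
  refine sum_abs_eigenvalues_sub_le hS' hT hn ?_ hq0 (fun x => ?_) hq2 I
  · have : c₀ ^ 2 ≤ 1 := pow_le_one₀ h0 h1
    have h2 : 0 ≤ 1 - c₀ := by linarith
    have h3 : 0 ≤ 1 - c₀ ^ 2 := by linarith
    positivity
  · refine le_trans (le_of_eq ?_) (hq1 x)
    rw [hS'in, hSA, hTA, hBapp, hBapp, inner_sub_left, inner_sub_left, inner_smul_left,
      inner_smul_left, inner_self_eq_norm_sq_to_K, inner_self_eq_norm_sq_to_K, X'.norm_map,
      Y.norm_map, map_sub, map_sub, sub_sub_sub_cancel_right, hX']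

end RitzValues

/-! ### Weak majorization through thresholds. -/

section Majorization

variable {k : ℕ}

lemma descending_antitone (y : Fin k → ℝ) : Antitone (descending y) := fun _ _ h =>
  Tuple.monotone_sort y (Fin.rev_le_rev.2 h)

/-- Taking as threshold the last entry of `descending y` within `Iic j`, and `I` of the same size as
`Iic j`, the right side equals exactly the sum of the largest entries of `y`: the positive parts
vanish beyond `j`, and the copies of the threshold cancel up to `j`. -/
lemma weaklySubmajorized_of_threshold {x y : Fin k → ℝ}
    (h : ∀ (I : Finset (Fin k)) (j : Fin k),
      ∑ i ∈ I, x i ≤ ∑ i, max (y i - y j) 0 + I.card * y j) :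
    WeaklySubmajorized x y := by
  intro j
  set e : Fin k ≃ Fin k := Fin.revPerm.trans (Tuple.sort x)
  set f : Fin k ≃ Fin k := Fin.revPerm.trans (Tuple.sort y)
  have hx : ∑ i ∈ Finset.Iic j, descending x i
      = ∑ i ∈ (Finset.Iic j).map e.toEmbedding, x i := by
    rw [Finset.sum_map]; rfl
  have hy : ∑ i, max (y i - y (f j)) 0
      = ∑ i, max (descending y i - descending y j) 0 :=
    (Equiv.sum_comp f fun i => max (y i - y (f j)) 0).symm
  rw [hx]
  refine (h _ (f j)).trans (le_of_eq ?_)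
  rw [hy, Finset.card_map, ← nsmul_eq_mul, ← Finset.sum_const,
    ← Finset.sum_subset (Finset.subset_univ (Finset.Iic j)), ← Finset.sum_add_distrib]
  · refine Finset.sum_congr rfl fun i hi => ?_
    rw [max_eq_left (sub_nonneg.2 (descending_antitone y (Finset.mem_Iic.1 hi)))]
    exact sub_add_cancel _ _
  · intro i _ hi
    rw [Finset.mem_Iic, not_le] at hi
    exact max_eq_right (sub_nonpos.2 (descending_antitone y hi.le))

end Majorization

/-! ### Translation from matrices to operators. -/

section Matrices

variable {n k : ℕ}

lemma eigs_eq {A : Matrix (Fin n) (Fin n) ℂ} (hA : A.IsHermitian) :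
    eigs hA = (Matrix.isSymmetric_toEuclideanLin_iff.mpr hA).eigenvalues
      (finrank_euclideanSpace_fin (𝕜 := ℂ) (n := n)) := by
  have key : ∀ {m : ℕ} (h : m = n) (hm : Module.finrank ℂ (EuclideanSpace ℂ (Fin n)) = m)
      (i : Fin n), (Matrix.isSymmetric_toEuclideanLin_iff.mpr hA).eigenvalues hm
        (Fin.cast h.symm i) = (Matrix.isSymmetric_toEuclideanLin_iff.mpr hA).eigenvalues
          (finrank_euclideanSpace_fin (𝕜 := ℂ) (n := n)) i := by
    rintro m rfl hm i
    rfl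
  funext i
  exact key (Fintype.card_fin n) _ i

lemma spr_nonneg {A : Matrix (Fin n) (Fin n) ℂ} (hA : A.IsHermitian) : 0 ≤ spr hA := by
  rw [spr]
  split_ifs with h
  · rw [sub_nonneg, eigs_eq]
    exact LinearMap.IsSymmetric.eigenvalues_antitone _ _ (Fin.mk_le_mk.2 (Nat.zero_le _))
  · rfl

lemma exists_norm_sub_smul_le_spr {A : Matrix (Fin n) (Fin n) ℂ} (hA : A.IsHermitian) :
    ∃ m : ℝ, ∀ w, ‖A.toEuclideanLin w - (m : ℂ) • w‖ ≤ spr hA / 2 * ‖w‖ := by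
  rcases Nat.eq_zero_or_pos n with rfl | hn
  · exact ⟨0, fun w => by simp [Subsingleton.elim w 0]⟩
  have hs := Matrix.isSymmetric_toEuclideanLin_iff.mpr hA
  have hf := finrank_euclideanSpace_fin (𝕜 := ℂ) (n := n)
  -- The midpoint of the spectrum lies within `spr hA / 2` of every eigenvalue.
  set m := (eigs hA ⟨0, hn⟩ + eigs hA ⟨n - 1, by omega⟩) / 2
  have hB : (A.toEuclideanLin - (m : ℂ) • LinearMap.id).IsSymmetric := fun x y => by
    simp only [LinearMap.sub_apply, LinearMap.smul_apply, LinearMap.id_apply, inner_sub_left,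
      inner_sub_right, inner_smul_left, inner_smul_right, hs x y, Complex.conj_ofReal]
  refine ⟨m, fun w => ?_⟩
  refine norm_apply_le hB (hs.eigenvectorBasis hf) (fun i => hs.eigenvalues hf i - m)
    (fun i => ?_) (by linarith [spr_nonneg hA]) (fun i => ?_) w
  · simp only [LinearMap.sub_apply, LinearMap.smul_apply, LinearMap.id_apply,
      hs.apply_eigenvectorBasis hf]
    rw [← sub_smul, Complex.ofReal_sub]
    rfl
  · have h1 : hs.eigenvalues hf i ≤ eigs hA ⟨0, hn⟩ := by
      rw [eigs_eq]
      exact hs.eigenvalues_antitone hf (Fin.mk_le_mk.2 (Nat.zero_le _))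
    have h2 : eigs hA ⟨n - 1, by omega⟩ ≤ hs.eigenvalues hf i := by
      rw [eigs_eq]
      exact hs.eigenvalues_antitone hf (Fin.mk_le_mk.2 (by omega))
    rw [spr, dif_pos hn, abs_le]
    constructor <;> simp only [m] <;> linarith

lemma toEuclideanLin_basisFun (X : Matrix (Fin n) (Fin k) ℂ) (j : Fin k) :
    X.toEuclideanLin (EuclideanSpace.basisFun (Fin k) ℂ j) = column X j := by
  rw [EuclideanSpace.basisFun_apply, EuclideanSpace.single, Matrix.toLpLin_toLp]
  ext i
  simp [column]

/-- The isometry with a given matrix whose columns are orthonormal. -/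
noncomputable def isometryOfOrthonormalColumns {X : Matrix (Fin n) (Fin k) ℂ}
    (hX : Orthonormal ℂ (column X)) :
    EuclideanSpace ℂ (Fin k) →ₗᵢ[ℂ] EuclideanSpace ℂ (Fin n) :=
  X.toEuclideanLin.isometryOfOrthonormal
    (v := (EuclideanSpace.basisFun (Fin k) ℂ).toBasis)
    (by rw [OrthonormalBasis.coe_toBasis]; exact OrthonormalBasis.orthonormal _)
    (by
      convert hX using 1
      funext j
      exact toEuclideanLin_basisFun X j)

lemma exists_apply_eq_of_isInvariantSubspace {A : Matrix (Fin n) (Fin n) ℂ}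
    {S : Submodule ℂ (EuclideanSpace ℂ (Fin n))} {X : Matrix (Fin n) (Fin k) ℂ}
    (hX : IsOrthonormalBasisOf X S) (hS : IsInvariantSubspace A S) (p : EuclideanSpace ℂ (Fin k)) :
    ∃ q, A.toEuclideanLin (isometryOfOrthonormalColumns hX.1 p)
      = isometryOfOrthonormalColumns hX.1 q := by
  have hrange : LinearMap.range X.toEuclideanLin = S := by
    rw [← hX.2, LinearMap.range_eq_map, ← (EuclideanSpace.basisFun (Fin k) ℂ).toBasis.span_eq,
      Submodule.map_span, ← Set.range_comp]
    congr 2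
    funext j
    exact toEuclideanLin_basisFun X j
  have h1 : X.toEuclideanLin p ∈ S := hrange ▸ LinearMap.mem_range_self _ p
  obtain ⟨q, hq⟩ := LinearMap.mem_range.1 (hrange.symm ▸ hS _ h1)
  exact ⟨q, hq.symm⟩

lemma inner_toEuclideanLin_conjTranspose_mul {m : ℕ} (X : Matrix (Fin n) (Fin k) ℂ)
    (B : Matrix (Fin n) (Fin m) ℂ) (p : EuclideanSpace ℂ (Fin k)) (q : EuclideanSpace ℂ (Fin m)) :
    inner ℂ p ((X.conjTranspose * B).toEuclideanLin q)
      = inner ℂ (X.toEuclideanLin p) (B.toEuclideanLin q) := by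
  rw [← LinearMap.adjoint_inner_right, ← Matrix.toEuclideanLin_conjTranspose_eq_adjoint]
  congr 1
  exact congrArg (fun f => f q) (Matrix.toLpLin_mul 2 2 2 X.conjTranspose B)

lemma inner_toEuclideanLin_compression {A : Matrix (Fin n) (Fin n) ℂ} (hA : A.IsHermitian)
    (X : Matrix (Fin n) (Fin k) ℂ) (p : EuclideanSpace ℂ (Fin k)) :
    inner ℂ ((X.conjTranspose * A * X).toEuclideanLin p) p
      = inner ℂ (A.toEuclideanLin (X.toEuclideanLin p)) (X.toEuclideanLin p) := by
  rw [Matrix.isSymmetric_toEuclideanLin_iff.mpr (Matrix.isHermitian_conjTranspose_mul_mul X hA),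
    Matrix.mul_assoc, inner_toEuclideanLin_conjTranspose_mul,
    Matrix.isSymmetric_toEuclideanLin_iff.mpr hA]
  congr 1
  exact congrArg (fun f => f p) (Matrix.toLpLin_mul 2 2 2 A X)

/-- Each singular value is an inner product of the unit vectors `X u` and `Y v`. The bound is what
makes `Real.cos` undo `Real.arccos` in `principalAngles`. -/
lemma singVals_le_one {X Y : Matrix (Fin n) (Fin k) ℂ} (hX : Orthonormal ℂ (column X))
    (hY : Orthonormal ℂ (column Y)) (i : Fin k) : singVals (X.conjTranspose * Y) i ≤ 1 := by
  obtain ⟨v, u, huv⟩ := exists_singularValue_bases (X.conjTranspose * Y).toEuclideanLin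
    (finrank_euclideanSpace_fin (𝕜 := ℂ) (n := k))
  have h1 := inner_toEuclideanLin_conjTranspose_mul X Y (u i) (v i)
  have h2 : ‖inner ℂ (X.toEuclideanLin (u i)) (Y.toEuclideanLin (v i))‖
      ≤ ‖X.toEuclideanLin (u i)‖ * ‖Y.toEuclideanLin (v i)‖ := norm_inner_le_norm _ _
  have h3 : ‖X.toEuclideanLin (u i)‖ = ‖u i‖ := (isometryOfOrthonormalColumns hX).norm_map _
  have h4 : ‖Y.toEuclideanLin (v i)‖ = ‖v i‖ := (isometryOfOrthonormalColumns hY).norm_map _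
  rw [← h1, huv, h3, h4, inner_smul_right, inner_self_eq_norm_sq_to_K] at h2
  refine (le_abs_self _).trans ?_
  simpa [singVals] using h2

end Matrices

end RitzBounds

open RitzBounds in
theorem theorem3p3 {n k : ℕ} (A : Matrix (Fin n) (Fin n) ℂ) (hA : A.IsHermitian)
    (S T : Submodule ℂ (EuclideanSpace ℂ (Fin n)))
    (X Y : Matrix (Fin n) (Fin k) ℂ)
    (hX : RitzBounds.IsOrthonormalBasisOf X S) (hY : RitzBounds.IsOrthonormalBasisOf Y T)
    (hinv : RitzBounds.IsInvariantSubspace A S ∨ RitzBounds.IsInvariantSubspace A T) :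
    RitzBounds.WeaklySubmajorized
      (fun i => |RitzBounds.eigs (Matrix.isHermitian_conjTranspose_mul_mul X hA) i
        - RitzBounds.eigs (Matrix.isHermitian_conjTranspose_mul_mul Y hA) i|)
      (fun i => RitzBounds.spr hA *
        (1 - Real.cos (RitzBounds.principalAngles X Y i)
          + 1 / 2 * Real.sin (RitzBounds.principalAngles X Y i) ^ 2)) := by
  set c : Fin k → ℝ := singVals (X.conjTranspose * Y)
  have hc0 : ∀ i, 0 ≤ c i := fun i => LinearMap.singularValues_nonneg _ _
  have hc1 : ∀ i, c i ≤ 1 := singVals_le_one hX.1 hY.1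
  have hcos : ∀ i, Real.cos (principalAngles X Y i) = c i.rev := fun i =>
    Real.cos_arccos (by linarith [hc0 i.rev]) (hc1 i.rev)
  simp only [Real.sin_sq, hcos]
  refine weaklySubmajorized_of_threshold fun I j => ?_
  obtain ⟨m, hm⟩ := exists_norm_sub_smul_le_spr hA
  have key := sum_abs_ritz_sub_le (Matrix.isSymmetric_toEuclideanLin_iff.mpr hA)
    (a := spr hA / 2) (by linarith [spr_nonneg hA]) hm
    (X := isometryOfOrthonormalColumns hX.1) (Y := isometryOfOrthonormalColumns hY.1)
    (hinv.imp (exists_apply_eq_of_isInvariantSubspace hX)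
      (exists_apply_eq_of_isInvariantSubspace hY))
    (Matrix.isSymmetric_toEuclideanLin_iff.mpr (Matrix.isHermitian_conjTranspose_mul_mul X hA))
    (Matrix.isSymmetric_toEuclideanLin_iff.mpr (Matrix.isHermitian_conjTranspose_mul_mul Y hA))
    (inner_toEuclideanLin_compression hA X) (inner_toEuclideanLin_compression hA Y)
    (K := (X.conjTranspose * Y).toEuclideanLin)
    (fun p q => (inner_toEuclideanLin_conjTranspose_mul X Y p q).symm)
    (finrank_euclideanSpace_fin (𝕜 := ℂ) (n := k)) (hc0 j.rev) (hc1 j.rev) I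
  rw [← eigs_eq, ← eigs_eq] at key
  refine key.trans (add_le_add (le_of_eq ?_) (le_of_eq ?_))
  · rw [← Equiv.sum_comp Fin.revPerm]
    refine Finset.sum_congr rfl fun i _ => ?_
    change 2 * (spr hA / 2) * (max (c j.rev - c i.rev) 0
      + 1 / 2 * max (c j.rev ^ 2 - c i.rev ^ 2) 0) = _
    have hs := spr_nonneg hA
    -- For nonnegative `c`, both `1 - c` and `1 - c ^ 2` decrease in `c`. Their threshold
    -- differences thus have the same sign, and the two positive parts merge into one.
    rcases le_total (c i.rev) (c j.rev) with h | h
    · have h2 := pow_le_pow_left₀ (hc0 i.rev) h 2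
      rw [max_eq_left (by linarith), max_eq_left (by linarith), max_eq_left]
      · ring
      · rw [← mul_sub]
        exact mul_nonneg hs (by linarith)
    · have h2 := pow_le_pow_left₀ (hc0 j.rev) h 2
      rw [max_eq_right (by linarith), max_eq_right (by linarith), max_eq_right]
      · ring
      · rw [← mul_sub]
        exact mul_nonpos_of_nonneg_of_nonpos hs (by linarith)
  · ring
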